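/- Let $(M,g)$ be a smooth Riemannian manifold of dimension $n\ge 3$ with Levi-Civita connection $\nabla$, Ricci tensor $\mathrm{Ric}$ and scalar curvature $\mathrm{scal}$. Let $V$ be a nowhere vanishing smooth vector field on $M$ and $\lambda$ a smooth function on $M$ such that $(V,\lambda)$ is an almost Einstein soliton, i.e. $$\tfrac12\,\pounds_V g+\mathrm{Ric}=\Big(\tfrac{\mathrm{scal}}{2}+\lambda\Big)g ,$$ and suppose that $V$ is concircular: $\nabla V=aI$, i.e. $\nabla_XV=aX$ for every vector field $X$, where $a$ is a smooth function on $M$. Put $\theta=i_Vg$, i.e. $\theta(X)=g(V,X)$. Then: (i) $\nabla\mathrm{Ric}=0$ if and only if $d\lambda=da$; (ii) $\nabla\mathrm{Ric}=\theta\otimes\mathrm{Ric}$, i.e. $(\nabla_X\mathrm{Ric})(Y,Z)=\theta(X)\,\mathrm{Ric}(Y,Z)$ for all smooth vector fields $X,Y,Z$, if and only if $\mathrm{grad}(\lambda-a)=(\lambda-a)V$; (iii) $(\nabla_X\mathrm{Ric})(Y,Z)=(\nabla_Y\mathrm{Ric})(X,Z)$ for all smooth vector fields $X,Y,Z$ if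 and only if $d(\lambda-a)\otimes I=I\otimes d(\lambda-a)$, i.e. $d(\lambda-a)(X)\,Y=d(\lambda-a)(Y)\,X$ for all $X,Y$; (iv) if $(\nabla_X\mathrm{Ric})(Y,Z)+(\nabla_Y\mathrm{Ric})(Z,X)+(\nabla_Z\mathrm{Ric})(X,Y)=0$ for all smooth vector fields $X,Y,Z$, then $$\mathrm{grad}(\lambda-a)=-2\,V(\lambda-a)\,\frac{V}{|V|^2}.$$ -/

import Mathlib

set_option linter.unusedSectionVars false
open Bundle Manifold VectorField
open scoped ContDiff Manifold

noncomputable section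
namespace RiemGeom
section Koszul
variable {E : Type*} [NormedAddCommGroup E] [NormedSpace ℝ E] [FiniteDimensional ℝ E]
  {H : Type*} [TopologicalSpace H] (I : ModelWithCorners ℝ E H)
  {M : Type*} [TopologicalSpace M] [ChartedSpace H M] [IsManifold I ∞ M]
  [RiemannianBundle (fun x : M ↦ TangentSpace I x)]
  [IsContMDiffRiemannianBundle I ∞ E (fun x : M ↦ TangentSpace I x)]

/-- The scalar product `g(X, Y)` of two vector fields, as a function on the manifold. -/
def metric (X Y : Π x : M, TangentSpace I x) (x : M) : ℝ := inner ℝ (X x) (Y x)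

/-- Half of the right-hand side of Koszul's formula. -/
def koszul (X Y Z : Π x : M, TangentSpace I x) (x : M) : ℝ :=
  (1 / 2) * (mvfderiv I (metric I Y Z) x (X x) + mvfderiv I (metric I X Z) x (Y x)
    - mvfderiv I (metric I X Y) x (Z x)
    + metric I (mlieBracket I X Y) Z x - metric I (mlieBracket I X Z) Y x
    - metric I (mlieBracket I Y Z) X x)

variable {I}

lemma mdiff_metric {X Y : Π x : M, TangentSpace I x} {x : M}
    (hX : MDiffAt (T% X) x) (hY : MDiffAt (T% Y) x) : MDiffAt (metric I X Y) x :=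
  MDifferentiableAt.inner_bundle (E := fun x : M ↦ TangentSpace I x) hX hY

lemma metric_smul_left (f : M → ℝ) (X Y : Π x : M, TangentSpace I x) :
    metric I (f • X) Y = fun x ↦ f x * metric I X Y x := by
  ext x; simp [metric, inner_smul_left]

lemma metric_smul_right (f : M → ℝ) (X Y : Π x : M, TangentSpace I x) :
    metric I X (f • Y) = fun x ↦ f x * metric I X Y x := by
  ext x; simp [metric, inner_smul_right]

lemma metric_add_left (X X' Y : Π x : M, TangentSpace I x) :
    metric I (X + X') Y = fun x ↦ metric I X Y x + metric I X' Y x := by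
  ext x; simp [metric, inner_add_left]

lemma metric_add_right (X Y Y' : Π x : M, TangentSpace I x) :
    metric I X (Y + Y') = fun x ↦ metric I X Y x + metric I X Y' x := by
  ext x; simp [metric, inner_add_right]

lemma metric_comm (X Y : Π x : M, TangentSpace I x) : metric I X Y = metric I Y X := by
  ext x; exact real_inner_comm _ _

lemma tensorial_left {Y Z : Π x : M, TangentSpace I x} {x : M}
    (hY : MDiffAt (T% Y) x) (hZ : MDiffAt (T% Z) x) :
    TensorialAt I E (fun X ↦ koszul I X Y Z x) x where
  smul {f X} hf hX := by
    simp only [koszul, metric_smul_left, mvfderiv_fun_mul hf (mdiff_metric hX hZ),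
      mvfderiv_fun_mul hf (mdiff_metric hX hY)]
    simp [metric, mlieBracket_smul_left hf hX, inner_add_left, inner_smul_left, inner_smul_right]
    rw [real_inner_comm (Z x) (X x)]
    ring
  add {X X'} hX hX' := by
    simp only [koszul, metric_add_left, mvfderiv_fun_add (mdiff_metric hX hZ) (mdiff_metric hX' hZ),
      mvfderiv_fun_add (mdiff_metric hX hY) (mdiff_metric hX' hY)]
    simp [metric, mlieBracket_add_left hX hX', inner_add_left, inner_add_right]
    ring


lemma tensorial_right {X Y : Π x : M, TangentSpace I x} {x : M}
    (hX : MDiffAt (T% X) x) (hY : MDiffAt (T% Y) x) :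
    TensorialAt I E (fun Z ↦ koszul I X Y Z x) x where
  smul {f Z} hf hZ := by
    simp only [koszul, metric_smul_right, mvfderiv_fun_mul hf (mdiff_metric hX hZ),
      mvfderiv_fun_mul hf (mdiff_metric hY hZ)]
    simp [metric, mlieBracket_smul_right hf hZ, inner_add_left, inner_smul_left]
    rw [real_inner_comm (Z x) (X x), real_inner_comm (Z x) (Y x)]
    ring
  add {Z Z'} hZ hZ' := by
    simp only [koszul, metric_add_right,
      mvfderiv_fun_add (mdiff_metric hX hZ) (mdiff_metric hX hZ'),
      mvfderiv_fun_add (mdiff_metric hY hZ) (mdiff_metric hY hZ')]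
    simp [metric, mlieBracket_add_right hZ hZ', inner_add_left]
    ring

/-- For a vector field `Y` differentiable at `x`, the bilinear form `(v, w) ↦ g(∇_v Y, w)` on the
tangent space at `x` given by Koszul's formula. -/
def koszulForm (Y : Π x : M, TangentSpace I x) (x : M) (hY : MDiffAt (T% Y) x) :
    TangentSpace I x →L[ℝ] TangentSpace I x →L[ℝ] ℝ :=
  TensorialAt.mkHom₂ (fun X Z ↦ koszul I X Y Z x) x
    (fun _ hZ ↦ tensorial_left hY hZ) (fun _ hX ↦ tensorial_right hX hY)

lemma koszulForm_apply {X Y Z : Π x : M, TangentSpace I x} {x : M} (hX : MDiffAt (T% X) x)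
    (hY : MDiffAt (T% Y) x) (hZ : MDiffAt (T% Z) x) :
    koszulForm Y x hY (X x) (Z x) = koszul I X Y Z x :=
  TensorialAt.mkHom₂_apply _ _ hX hZ

instance finiteDimensional_tangentSpace (x : M) : FiniteDimensional ℝ (TangentSpace I x) :=
  inferInstanceAs (FiniteDimensional ℝ E)

/-- The linear map `v ↦ ♯ (B v)` of a tangent space attached to a bilinear form `B`. -/
def raise {x : M} (B : TangentSpace I x →L[ℝ] TangentSpace I x →L[ℝ] ℝ) :
    TangentSpace I x →L[ℝ] TangentSpace I x :=
  LinearMap.toContinuousLinearMap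
    { toFun v := (InnerProductSpace.toDual ℝ (TangentSpace I x)).symm (B v)
      map_add' v w := by simp
      map_smul' c v := by simp }

lemma inner_raise {x : M} (B : TangentSpace I x →L[ℝ] TangentSpace I x →L[ℝ] ℝ)
    (v w : TangentSpace I x) : inner ℝ (raise B v) w = B v w := by
  simp [raise]


open Classical in
/-- The covariant derivative of a vector field `Y` at `x`, as an endomorphism `v ↦ ∇_v Y` of the
tangent space at `x`, given by Koszul's formula (and `0` if `Y` is not differentiable at `x`). -/
def koszulDeriv (Y : Π x : M, TangentSpace I x) (x : M) :
    TangentSpace I x →L[ℝ] TangentSpace I x :=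
  if hY : MDiffAt (T% Y) x then raise (koszulForm Y x hY) else 0

lemma inner_koszulDeriv {X Y Z : Π x : M, TangentSpace I x} {x : M} (hX : MDiffAt (T% X) x)
    (hY : MDiffAt (T% Y) x) (hZ : MDiffAt (T% Z) x) :
    inner ℝ (koszulDeriv Y x (X x)) (Z x) = koszul I X Y Z x := by
  rw [koszulDeriv, dif_pos hY, inner_raise, koszulForm_apply hX hY hZ]

/-- To identify an endomorphism of a tangent space, test it on vector fields. -/
lemma ext_fields {x : M} {A B : TangentSpace I x →L[ℝ] TangentSpace I x}
    (h : ∀ X Z : Π x : M, TangentSpace I x, MDiffAt (T% X) x → MDiffAt (T% Z) x →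
      (inner ℝ (A (X x)) (Z x) : ℝ) = inner ℝ (B (X x)) (Z x)) : A = B := by
  ext1 v
  refine ext_inner_right ℝ fun w ↦ ?_
  have := h (FiberBundle.extend E v) (FiberBundle.extend E w)
    (FiberBundle.mdifferentiableAt_extend I E v) (FiberBundle.mdifferentiableAt_extend I E w)
  simpa using this

lemma isCovariantDerivativeOn_koszulDeriv :
    IsCovariantDerivativeOn E (koszulDeriv (I := I) (M := M)) where
  add {Y Y' x} hY hY' _ := by
    refine ext_fields fun X Z hX hZ ↦ ?_
    have hs : MDiffAt (T% (Y + Y')) x := mdifferentiableAt_add_section hY hY'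
    rw [inner_koszulDeriv hX hs hZ, _root_.add_apply, inner_add_left,
      inner_koszulDeriv hX hY hZ, inner_koszulDeriv hX hY' hZ]
    simp only [koszul, metric_add_left, metric_add_right,
      mvfderiv_fun_add (mdiff_metric hY hZ) (mdiff_metric hY' hZ),
      mvfderiv_fun_add (mdiff_metric hX hY) (mdiff_metric hX hY')]
    simp [metric, mlieBracket_add_left hY hY', mlieBracket_add_right hY hY', inner_add_left]
    ring
  leibniz {Y f x} hY hf _ := by
    refine ext_fields fun X Z hX hZ ↦ ?_
    have hs : MDiffAt (T% (f • Y)) x := hf.smul_section hY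
    rw [inner_koszulDeriv hX hs hZ, _root_.add_apply, inner_add_left,
      _root_.smul_apply, inner_smul_left, inner_koszulDeriv hX hY hZ]
    simp only [koszul, metric_smul_left, metric_smul_right,
      mvfderiv_fun_mul hf (mdiff_metric hY hZ), mvfderiv_fun_mul hf (mdiff_metric hX hY)]
    simp [metric, mlieBracket_smul_left hf hY, mlieBracket_smul_right hf hY, inner_add_left,
      inner_smul_left]
    rw [real_inner_comm (X x) (Y x)]
    ring

variable (I M) in
/-- The Levi-Civita connection of the Riemannian metric. -/
def leviCivita : CovariantDerivative I E (fun x : M ↦ TangentSpace I x) where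
  toFun := koszulDeriv
  isCovariantDerivativeOnUniv := isCovariantDerivativeOn_koszulDeriv

/-- The Levi-Civita connection is torsion-free. -/
theorem leviCivita_torsion_free {X Y : Π x : M, TangentSpace I x} {x : M}
    (hX : MDiffAt (T% X) x) (hY : MDiffAt (T% Y) x) :
    leviCivita I M Y x (X x) - leviCivita I M X x (Y x) = mlieBracket I X Y x := by
  refine ext_inner_right ℝ fun w ↦ ?_
  have hZ := FiberBundle.mdifferentiableAt_extend I E w
  have h1 := inner_koszulDeriv hX hY hZ
  have h2 := inner_koszulDeriv hY hX hZ
  simp only [FiberBundle.extend_apply_self] at h1 h2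
  rw [inner_sub_left]
  change inner ℝ (koszulDeriv Y x (X x)) w - inner ℝ (koszulDeriv X x (Y x)) w = _
  rw [h1, h2, koszul, koszul, metric_comm Y X]
  simp only [metric, FiberBundle.extend_apply_self]
  rw [mlieBracket_swap (V := Y) (W := X)]
  simp only [Pi.neg_apply, inner_neg_left]
  ring

/-- The Levi-Civita connection is compatible with the metric. -/
theorem leviCivita_metric {X Y Z : Π x : M, TangentSpace I x} {x : M}
    (hX : MDiffAt (T% X) x) (hY : MDiffAt (T% Y) x) (hZ : MDiffAt (T% Z) x) :
    mvfderiv I (metric I Y Z) x (X x) =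
      inner ℝ (leviCivita I M Y x (X x)) (Z x) + inner ℝ (Y x) (leviCivita I M Z x (X x)) := by
  rw [real_inner_comm _ (Y x)]
  change _ = inner ℝ (koszulDeriv Y x (X x)) (Z x) + inner ℝ (koszulDeriv Z x (X x)) (Y x)
  rw [inner_koszulDeriv hX hY hZ, inner_koszulDeriv hX hZ hY, koszul, koszul, metric_comm Z Y]
  simp only [metric]
  rw [mlieBracket_swap (V := Z) (W := Y)]
  simp only [Pi.neg_apply, inner_neg_left]
  ring

end Koszul

section Curvature

variable {E : Type*} [NormedAddCommGroup E] [NormedSpace ℝ E] [FiniteDimensional ℝ E]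
  {H : Type*} [TopologicalSpace H] (I : ModelWithCorners ℝ E H)
  {M : Type*} [TopologicalSpace M] [ChartedSpace H M] [IsManifold I ∞ M]
  [RiemannianBundle (fun x : M ↦ TangentSpace I x)]
  [IsContMDiffRiemannianBundle I ∞ E (fun x : M ↦ TangentSpace I x)]

/-- Smooth vector fields. -/
def IsSmoothField (X : Π x : M, TangentSpace I x) : Prop :=
  CMDiff ∞ (T% X)

/-- The vector field `∇_X Y`. -/
def nabla (X Y : Π x : M, TangentSpace I x) : Π x : M, TangentSpace I x :=
  fun x ↦ leviCivita I M Y x (X x)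

/-- The curvature `R(X, Y)Z = ∇_X ∇_Y Z - ∇_Y ∇_X Z - ∇_[X, Y] Z` of three vector fields. -/
def riemann (X Y Z : Π x : M, TangentSpace I x) : Π x : M, TangentSpace I x :=
  nabla I X (nabla I Y Z) - nabla I Y (nabla I X Z) - nabla I (mlieBracket I X Y) Z

/-- The Riemann curvature tensor at `x`, computed by extending the three tangent vectors to vector
fields which are smooth near `x` (its value does not depend on the extensions). -/
def riemannAt (x : M) (u v w : TangentSpace I x) : TangentSpace I x :=
  riemann I (FiberBundle.extend E u) (FiberBundle.extend E v) (FiberBundle.extend E w) x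

/-- The Ricci curvature `Ric(v, w) = tr (u ↦ R(u, v)w)`; the trace is computed in an orthonormal
basis. -/
def ricci (x : M) (v w : TangentSpace I x) : ℝ :=
  ∑ i, inner ℝ (riemannAt I x (stdOrthonormalBasis ℝ (TangentSpace I x) i) v w)
    (stdOrthonormalBasis ℝ (TangentSpace I x) i)

/-- The scalar curvature, the trace of the Ricci curvature. -/
def scal (x : M) : ℝ :=
  ∑ i, ricci I x (stdOrthonormalBasis ℝ (TangentSpace I x) i)
    (stdOrthonormalBasis ℝ (TangentSpace I x) i)

/-- The function `Ric(Y, Z)`. -/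
def ricciFun (Y Z : Π x : M, TangentSpace I x) (x : M) : ℝ := ricci I x (Y x) (Z x)

/-- `(∇_X Ric)(Y, Z) = X(Ric(Y, Z)) - Ric(∇_X Y, Z) - Ric(Y, ∇_X Z)`. -/
def nablaRicci (X Y Z : Π x : M, TangentSpace I x) (x : M) : ℝ :=
  mvfderiv I (ricciFun I Y Z) x (X x) - ricciFun I (nabla I X Y) Z x - ricciFun I Y (nabla I X Z) x

/-- The Lie derivative of the metric:
`(£_V g)(Y, Z) = V(g(Y, Z)) - g([V, Y], Z) - g(Y, [V, Z])`. -/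
def lieDerivMetric (V Y Z : Π x : M, TangentSpace I x) (x : M) : ℝ :=
  mvfderiv I (metric I Y Z) x (V x) - metric I (mlieBracket I V Y) Z x
    - metric I Y (mlieBracket I V Z) x

/-- The gradient of a function: `g(grad f, v) = df(v)`. -/
def grad (f : M → ℝ) (x : M) : TangentSpace I x :=
  (InnerProductSpace.toDual ℝ (TangentSpace I x)).symm (mvfderiv I f x)

variable {I} in
/-- The tensor product `α ⊗ I` of a `1`-form and the identity: `(α ⊗ I)(v, w) = α(v) w`. -/
def formTensorId {x : M} (α : TangentSpace I x →L[ℝ] ℝ) (v w : TangentSpace I x) :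
    TangentSpace I x := α v • w

variable {I} in
/-- The tensor product `I ⊗ α` of the identity and a `1`-form: `(I ⊗ α)(v, w) = α(w) v`. -/
def idTensorForm {x : M} (α : TangentSpace I x →L[ℝ] ℝ) (v w : TangentSpace I x) :
    TangentSpace I x := α w • v

/-- `(V, lam)` is an almost Einstein soliton: `V` is a nowhere vanishing smooth vector field and
`lam` a smooth function with `(1/2) £_V g + Ric = (scal/2 + lam) g`. -/
structure IsAlmostEinsteinSoliton (V : Π x : M, TangentSpace I x) (lam : M → ℝ) : Prop where
  smooth_field : IsSmoothField I V
  smooth_fun : ContMDiff I 𝓘(ℝ) ∞ lam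
  ne_zero : ∀ x, V x ≠ 0
  eqn : ∀ Y Z : Π x : M, TangentSpace I x, IsSmoothField I Y → IsSmoothField I Z → ∀ x : M,
    (1 / 2) * lieDerivMetric I V Y Z x + ricciFun I Y Z x = (scal I x / 2 + lam x) * metric I Y Z x

/-- `V` is a concircular vector field with `∇V = aI`. -/
def IsConcircular (V : Π x : M, TangentSpace I x) (a : M → ℝ) : Prop :=
  ∀ (x : M) (v : TangentSpace I x), leviCivita I M V x v = a x • v

end Curvature
end RiemGeom
end

/-!
A concircular field `V` with `∇V = aI` satisfies `(1/2) £_V g = a g`, so the soliton equation becomes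
`Ric = (scal/2 + λ - a) g`. Tracing it gives `scal = n (scal/2 + λ - a)`, and since `n ≥ 3` this can
be solved for `scal`: the metric is pointwise Einstein, with
`Ric = κ g` and `κ = -(2/(n-2)) (λ - a)` (`ricci_eq_of_soliton`).
As `∇g = 0`, it follows that `(∇_X Ric)(Y, Z) = dκ(X) g(Y, Z)` (`nablaRicci_of_ricci_eq`), and every
condition in the theorem turns into a pointwise linear condition on `d(λ - a)`. It is tested with
`Y = Z = V` for (i), (ii) and (iv), where `g(V, V) ≠ 0` can be cancelled, and with arbitrary
vectors for (iii).

The hypotheses speak of globally defined smooth fields only, while the trace and the tests are made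
on tangent vectors at a point; `exists_isSmoothField` provides the passage.
-/

noncomputable section
namespace RiemGeom

variable {E : Type*} [NormedAddCommGroup E] [NormedSpace ℝ E] [FiniteDimensional ℝ E]
  {H : Type*} [TopologicalSpace H] {I : ModelWithCorners ℝ E H}
  {M : Type*} [TopologicalSpace M] [ChartedSpace H M] [IsManifold I ∞ M]

/-- Every tangent vector is the value of a globally defined smooth vector field: multiply a local
smooth extension by a bump function. -/
lemma exists_isSmoothField [T2Space M] (x : M) (v : TangentSpace I x) :
    ∃ X : Π x : M, TangentSpace I x, IsSmoothField I X ∧ X x = v := by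
  have : IsManifold I (∞ + 1) M := inferInstanceAs (IsManifold I ∞ M)
  obtain ⟨s, hs, hext⟩ := FiberBundle.exists_contMDiffOn_extend (k := ∞) I E v
  obtain ⟨u, hus, hu, hxu⟩ := mem_nhds_iff.mp hs
  obtain ⟨f, -, hf⟩ := ((SmoothBumpFunction.nhds_basis_tsupport (I := I) x).mem_iff).mp
    (hu.mem_nhds hxu)
  refine ⟨(f : M → ℝ) • FiberBundle.extend E v, ?_, ?_⟩
  · exact ContMDiffOn.smul_section_of_tsupport f.contMDiff.contMDiffOn hu hf (hext.mono hus)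
  · simp

variable [RiemannianBundle (fun x : M ↦ TangentSpace I x)]

lemma IsSmoothField.mdifferentiableAt {X : Π x : M, TangentSpace I x} (hX : IsSmoothField I X)
    (x : M) : MDiffAt (T% X) x :=
  (ContMDiff.mdifferentiable hX (by simp)) x

lemma grad_eq_iff {f : M → ℝ} {x : M} {w : TangentSpace I x} :
    grad I f x = w ↔ ∀ v : TangentSpace I x, mvfderiv I f x v = inner ℝ w v := by
  rw [grad, LinearIsometryEquiv.symm_apply_eq]
  constructor
  · intro h v
    rw [h, InnerProductSpace.toDual_apply_apply]
  · intro h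
    ext v
    rw [h, InnerProductSpace.toDual_apply_apply]

variable [IsContMDiffRiemannianBundle I ∞ E (fun x : M ↦ TangentSpace I x)]

/-- If `∇V = aI` then `£_V g = 2a g`, because `∇` is metric and torsion-free. -/
lemma IsConcircular.lieDerivMetric_eq {V : Π x : M, TangentSpace I x} {a : M → ℝ}
    (h : IsConcircular I V a) {Y Z : Π x : M, TangentSpace I x} {x : M}
    (hV : MDiffAt (T% V) x) (hY : MDiffAt (T% Y) x) (hZ : MDiffAt (T% Z) x) :
    lieDerivMetric I V Y Z x = 2 * a x * metric I Y Z x := by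
  rw [lieDerivMetric, leviCivita_metric hV hY hZ]
  simp only [metric, ← leviCivita_torsion_free hV hY, ← leviCivita_torsion_free hV hZ, h x,
    inner_sub_left, inner_sub_right, real_inner_smul_left, real_inner_smul_right]
  ring

/-- If `Ric = κ g` then `∇Ric = dκ ⊗ g`, because `∇g = 0`. -/
lemma nablaRicci_of_ricci_eq {κ : M → ℝ}
    (h : ∀ (x : M) (v w : TangentSpace I x), ricci I x v w = κ x * inner ℝ v w)
    {X Y Z : Π x : M, TangentSpace I x} {x : M} (hκ : MDiffAt κ x)
    (hX : MDiffAt (T% X) x) (hY : MDiffAt (T% Y) x) (hZ : MDiffAt (T% Z) x) :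
    nablaRicci I X Y Z x = mvfderiv I κ x (X x) * inner ℝ (Y x) (Z x) := by
  have hfun : ricciFun I Y Z = fun p ↦ κ p * metric I Y Z p := by
    ext p
    exact h p _ _
  rw [nablaRicci, hfun, mvfderiv_fun_mul hκ (mdiff_metric hY hZ)]
  have hmet := leviCivita_metric hX hY hZ
  simp only [_root_.add_apply, _root_.smul_apply, smul_eq_mul, hmet, ricciFun, h, nabla, metric]
  ring

/-- An almost Einstein soliton with concircular field is pointwise Einstein in dimension at
least `3`: the trace of the soliton equation determines the scalar curvature. -/
lemma ricci_eq_of_soliton [T2Space M] (hdim : 3 ≤ Module.finrank ℝ E)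
    {V : Π x : M, TangentSpace I x} {lam a : M → ℝ}
    (hsol : IsAlmostEinsteinSoliton I V lam) (hV : IsConcircular I V a)
    (x : M) (v w : TangentSpace I x) :
    ricci I x v w = -2 / ((Module.finrank ℝ E : ℝ) - 2) * (lam x - a x) * inner ℝ v w := by
  have key : ∀ v w : TangentSpace I x,
      ricci I x v w = (scal I x / 2 + lam x - a x) * inner ℝ v w := by
    intro v w
    obtain ⟨Y, hY, rfl⟩ := exists_isSmoothField x v
    obtain ⟨Z, hZ, rfl⟩ := exists_isSmoothField x w
    have h := hsol.eqn Y Z hY hZ x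
    rw [hV.lieDerivMetric_eq (hsol.smooth_field.mdifferentiableAt x) (hY.mdifferentiableAt x)
      (hZ.mdifferentiableAt x)] at h
    simp only [ricciFun, metric] at h
    linear_combination h
  have htrace : scal I x = Module.finrank ℝ E * (scal I x / 2 + lam x - a x) := by
    have hfr : Module.finrank ℝ (TangentSpace I x) = Module.finrank ℝ E := rfl
    -- only the left-hand occurrence of `scal` is expanded as the trace of `ricci`
    conv_lhs => rw [scal]
    simp [key, hfr]
    ring
  have hn : (3 : ℝ) ≤ Module.finrank ℝ E := by exact_mod_cast hdim
  have hn' : (Module.finrank ℝ E : ℝ) - 2 ≠ 0 := by linarith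
  rw [key]
  congr 1
  field_simp
  linear_combination -2 * htrace

end RiemGeom
end

open RiemGeom in
theorem mainTheorem5 {n : ℕ} (hn : 3 ≤ n)
    {M : Type*} [TopologicalSpace M] [T2Space M] [SecondCountableTopology M]
    [ChartedSpace (EuclideanSpace ℝ (Fin n)) M] [IsManifold (𝓡 n) ∞ M]
    [RiemannianBundle (fun x : M ↦ TangentSpace (𝓡 n) x)]
    [IsContMDiffRiemannianBundle (𝓡 n) ∞ (EuclideanSpace ℝ (Fin n))
      (fun x : M ↦ TangentSpace (𝓡 n) x)]
    (V : Π x : M, TangentSpace (𝓡 n) x) (lam a : M → ℝ)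
    (hsol : IsAlmostEinsteinSoliton (𝓡 n) V lam)
    (ha : ContMDiff (𝓡 n) 𝓘(ℝ) ∞ a)
    (hV : IsConcircular (𝓡 n) V a) :
    -- (i) parallel Ricci tensor
    ((∀ X Y Z : Π x : M, TangentSpace (𝓡 n) x, IsSmoothField (𝓡 n) X → IsSmoothField (𝓡 n) Y →
        IsSmoothField (𝓡 n) Z → ∀ x, nablaRicci (𝓡 n) X Y Z x = 0) ↔
      ∀ x, mvfderiv (𝓡 n) lam x = mvfderiv (𝓡 n) a x) ∧
    -- (ii) recurrent Ricci tensor, with respect to the 1-form dual to V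
    ((∀ X Y Z : Π x : M, TangentSpace (𝓡 n) x, IsSmoothField (𝓡 n) X → IsSmoothField (𝓡 n) Y →
        IsSmoothField (𝓡 n) Z → ∀ x,
          nablaRicci (𝓡 n) X Y Z x = metric (𝓡 n) V X x * ricciFun (𝓡 n) Y Z x) ↔
      ∀ x, grad (𝓡 n) (fun p ↦ lam p - a p) x = (lam x - a x) • V x) ∧
    -- (iii) Codazzi condition
    ((∀ X Y Z : Π x : M, TangentSpace (𝓡 n) x, IsSmoothField (𝓡 n) X → IsSmoothField (𝓡 n) Y →
        IsSmoothField (𝓡 n) Z → ∀ x,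
          nablaRicci (𝓡 n) X Y Z x = nablaRicci (𝓡 n) Y X Z x) ↔
      ∀ x, formTensorId (mvfderiv (𝓡 n) (fun p ↦ lam p - a p) x) =
        idTensorForm (mvfderiv (𝓡 n) (fun p ↦ lam p - a p) x)) ∧
    -- (iv) cyclic sum condition
    ((∀ X Y Z : Π x : M, TangentSpace (𝓡 n) x, IsSmoothField (𝓡 n) X → IsSmoothField (𝓡 n) Y →
        IsSmoothField (𝓡 n) Z → ∀ x,
          nablaRicci (𝓡 n) X Y Z x + nablaRicci (𝓡 n) Y Z X x + nablaRicci (𝓡 n) Z X Y x = 0) →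
      ∀ x, grad (𝓡 n) (fun p ↦ lam p - a p) x =
        (-2 * mvfderiv (𝓡 n) (fun p ↦ lam p - a p) x (V x) / metric (𝓡 n) V V x) • V x) := by
  set μ : M → ℝ := fun p ↦ lam p - a p with hμ
  set c : ℝ := -2 / ((n : ℝ) - 2) with hc
  have hn' : (3 : ℝ) ≤ n := by exact_mod_cast hn
  have hc0 : c ≠ 0 := div_ne_zero (by norm_num) (by linarith)
  have hlamd (x : M) : MDifferentiableAt (𝓡 n) 𝓘(ℝ) lam x := hsol.smooth_fun.mdifferentiable (by simp) x
  have had (x : M) : MDifferentiableAt (𝓡 n) 𝓘(ℝ) a x := ha.mdifferentiable (by simp) x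
  have hμd (x : M) : MDifferentiableAt (𝓡 n) 𝓘(ℝ) μ x := (hlamd x).sub (had x)
  have hric (x : M) (v w : TangentSpace (𝓡 n) x) :
      ricci (𝓡 n) x v w = c * μ x * inner ℝ v w := by
    have h := ricci_eq_of_soliton (by simpa using hn) hsol hV x v w
    rwa [finrank_euclideanSpace_fin] at h
  have hnab {X Y Z : Π x : M, TangentSpace (𝓡 n) x} (hX : IsSmoothField (𝓡 n) X)
      (hY : IsSmoothField (𝓡 n) Y) (hZ : IsSmoothField (𝓡 n) Z) (x : M) :
      nablaRicci (𝓡 n) X Y Z x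
        = c * mvfderiv (𝓡 n) μ x (X x) * inner ℝ (Y x) (Z x) := by
    rw [nablaRicci_of_ricci_eq (κ := fun p ↦ c * μ p) hric (mdifferentiableAt_const.mul (hμd x))
      (hX.mdifferentiableAt x) (hY.mdifferentiableAt x) (hZ.mdifferentiableAt x),
      mvfderiv_fun_mul mdifferentiableAt_const (hμd x)]
    simp [mvfderiv_const]
  have hVs := hsol.smooth_field
  have hVV (x : M) : (inner ℝ (V x) (V x) : ℝ) ≠ 0 := inner_self_ne_zero.mpr (hsol.ne_zero x)
  refine ⟨⟨fun h x ↦ ?_, fun h X Y Z hX hY hZ x ↦ ?_⟩,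
    ⟨fun h x ↦ grad_eq_iff.mpr fun v ↦ ?_, fun h X Y Z hX hY hZ x ↦ ?_⟩,
    ⟨fun h x ↦ ?_, fun h X Y Z hX hY hZ x ↦ ?_⟩, fun h x ↦ grad_eq_iff.mpr fun v ↦ ?_⟩
  · rw [← sub_eq_zero, ← mvfderiv_fun_sub (hlamd x) (had x)]
    ext v
    obtain ⟨X, hX, rfl⟩ := exists_isSmoothField x v
    have h1 := h X V V hX hVs hVs x
    rw [hnab hX hVs hVs] at h1
    simpa [hc0, hsol.ne_zero x] using h1
  · have h1 : mvfderiv (𝓡 n) μ x = 0 := by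
      rw [hμ, mvfderiv_fun_sub (hlamd x) (had x), h x, sub_self]
    rw [hnab hX hY hZ, h1]
    simp
  · obtain ⟨X, hX, rfl⟩ := exists_isSmoothField x v
    have h1 := h X V V hX hVs hVs x
    rw [hnab hX hVs hVs, ricciFun, hric, metric] at h1
    rw [real_inner_smul_left]
    refine mul_left_cancel₀ (mul_ne_zero hc0 (hVV x)) ?_
    linear_combination h1
  · rw [hnab hX hY hZ, ricciFun, hric, metric, grad_eq_iff.mp (h x) (X x), real_inner_smul_left]
    ring
  · funext v w
    obtain ⟨X, hX, rfl⟩ := exists_isSmoothField x v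
    obtain ⟨Y, hY, rfl⟩ := exists_isSmoothField x w
    refine ext_inner_right ℝ fun z ↦ ?_
    obtain ⟨Z, hZ, rfl⟩ := exists_isSmoothField x z
    have h1 := h X Y Z hX hY hZ x
    rw [hnab hX hY hZ, hnab hY hX hZ] at h1
    rw [formTensorId, idTensorForm, real_inner_smul_left, real_inner_smul_left]
    refine mul_left_cancel₀ hc0 ?_
    linear_combination h1
  · have h1 := congrArg (fun w ↦ (inner ℝ w (Z x) : ℝ)) (congrFun₂ (h x) (X x) (Y x))
    simp only [formTensorId, idTensorForm, real_inner_smul_left] at h1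
    rw [hnab hX hY hZ, hnab hY hX hZ]
    linear_combination c * h1
  · obtain ⟨X, hX, rfl⟩ := exists_isSmoothField x v
    have h1 := h X V V hX hVs hVs x
    rw [hnab hX hVs hVs, hnab hVs hVs hX, hnab hVs hX hVs, real_inner_comm (V x) (X x)] at h1
    rw [real_inner_smul_left, metric, div_mul_eq_mul_div, eq_div_iff (hVV x)]
    refine mul_left_cancel₀ hc0 ?_
    linear_combination h1
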